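/- Let $n\ge 1$ and let $C_n$ be the hyperoctahedral group, that is, the group of orthogonal transformations $\alpha$ of $\mathbb{R}^n$ with $\alpha([-1,1]^n)=[-1,1]^n$. For $\alpha\in C_n$ let $l(\alpha)$ be the least $k$ such that $\alpha$ is a product of $k$ reflections belonging to $C_n$, and put $\alpha\le\beta$ if and only if $l(\beta)=l(\alpha)+l(\alpha^{-1}\beta)$. Write $e_{-i}=-e_i$ for $1\le i\le n$, where $e_1,\dots,e_n$ is the standard basis, so that $C_n$ acts on $A=\{1,\dots,n,-1,\dots,-n\}$ by $\alpha(e_a)=e_{\alpha(a)}$. Let $\gamma_C=[1,2,\dots,n]\in C_n$ be the Coxeter element with $e_1\mapsto e_2\mapsto\cdots\mapsto e_n\mapsto -e_1$, and let $[I,\gamma_C]=\{\alpha\in C_n:\alpha\le\gamma_C\}$. Let $NCP$ be Reiner's poset of noncrossing partitions of type $B_n$: the partitions $\pi$ of $A$ such that (i) $-B$ is a block of $\pi$ for each block $B$ of $\pi$; (ii) at most one block $B$ satisfies $B=-B$; (iii) $\pi$ is noncrossing for the circular order $1,2,\dots,n,-1,-2,\dots,-n$, i.e. there are no $a,b,c,d$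 occurring in this order in the list $1,2,\dots,n,-1,\dots,-n$ with $a,c$ in one block and $b,d$ in a different block. Order $NCP$ by refinement ($\pi\le\pi'$ if and only if each block of $\pi$ is contained in a block of $\pi'$). Then sending $\alpha\in[I,\gamma_C]$ to the partition of $A$ into the cycles (orbits) of the permutation that $\alpha$ induces on $A$ is a well-defined bijection $[I,\gamma_C]\to NCP$ which is an isomorphism of posets: $\alpha\le\beta$ if and only if the partition of $\alpha$ refines that of $\beta$. In particular, $[I,\gamma_C]$, with the order $\le$, is a lattice. -/

import Mathlib

noncomputable section

namespace CubeGroup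

/-- The cube `[-1,1]^n` in Euclidean space `ℝ^n`. -/
def cube (n : ℕ) : Set (EuclideanSpace ℝ (Fin n)) :=
  {x | ∀ i, x i ∈ Set.Icc (-1 : ℝ) 1}

/-- The hyperoctahedral group `C_n`: the orthogonal transformations of `ℝ^n` that map the cube
`[-1,1]^n` onto itself. The product is composition, `(α * β) x = α (β x)`. -/
def hyperoctahedral (n : ℕ) :
    Subgroup (EuclideanSpace ℝ (Fin n) ≃ₗᵢ[ℝ] EuclideanSpace ℝ (Fin n)) where
  carrier := {α | α '' cube n = cube n}
  one_mem' := by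
    show (fun x => x) '' cube n = cube n
    exact Set.image_id _
  mul_mem' := by
    intro α β (hα : α '' cube n = cube n) (hβ : β '' cube n = cube n)
    show (fun x => α (β x)) '' cube n = cube n
    have h : (fun x => α (β x)) '' cube n = α '' (β '' cube n) := by
      rw [Set.image_image]
    rw [h, hβ, hα]
  inv_mem' := by
    intro α hα
    have hα' : α '' cube n = cube n := hα
    show (fun x => α.symm x) '' cube n = cube n
    conv_lhs => rw [← hα']
    rw [Set.image_image]
    simp

/-- An element of `C_n` is a reflection if it is the orthogonal reflection in some hyperplane
`v^⊥`, with `v ≠ 0`. -/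
def IsReflection {n : ℕ} (α : hyperoctahedral n) : Prop :=
  ∃ v : EuclideanSpace ℝ (Fin n), v ≠ 0 ∧
    (α : EuclideanSpace ℝ (Fin n) ≃ₗᵢ[ℝ] EuclideanSpace ℝ (Fin n)) = (ℝ ∙ v)ᗮ.reflection

/-- Reflection length: the least number of reflections of `C_n` whose product is `α`
(every element of `C_n` is such a product). -/
def reflectionLength {n : ℕ} (α : hyperoctahedral n) : ℕ :=
  sInf {k | ∃ L : List (hyperoctahedral n),
    L.length = k ∧ (∀ R ∈ L, IsReflection R) ∧ L.prod = α}

/-- The order given by reflection length: `α ≤ β` iff `l(β) = l(α) + l(α⁻¹ β)`. -/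
def ReflLE {n : ℕ} (α β : hyperoctahedral n) : Prop :=
  reflectionLength β = reflectionLength α + reflectionLength (α⁻¹ * β)

/-- The orthogonal map of `ℝ^n` with `e_1 ↦ e_2 ↦ ⋯ ↦ e_n ↦ -e_1`: the cyclic permutation of the
coordinates, followed by a change of sign of the first coordinate. -/
def coxeterIsometry (n : ℕ) : EuclideanSpace ℝ (Fin n) ≃ₗᵢ[ℝ] EuclideanSpace ℝ (Fin n) :=
  (LinearIsometryEquiv.piLpCongrLeft 2 ℝ ℝ (finRotate n)).trans
    (LinearIsometryEquiv.piLpCongrRight 2 fun i : Fin n =>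
      if (i : ℕ) = 0 then LinearIsometryEquiv.neg ℝ else LinearIsometryEquiv.refl ℝ ℝ)

theorem coxeterIsometry_apply {n : ℕ} (x : EuclideanSpace ℝ (Fin n)) (i : Fin n) :
    coxeterIsometry n x i =
      if (i : ℕ) = 0 then -x ((finRotate n).symm i) else x ((finRotate n).symm i) := by
  by_cases h : (i : ℕ) = 0 <;>
    simp [coxeterIsometry, h, LinearIsometryEquiv.piLpCongrLeft_apply, Equiv.piCongrLeft']

/-- The Coxeter element `γ_C = [1,2,…,n]` of `C_n`. -/
def coxeterElement (n : ℕ) : hyperoctahedral n :=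
  ⟨coxeterIsometry n, by
    have key : ∀ x, coxeterIsometry n x ∈ cube n ↔ x ∈ cube n := by
      intro x
      have h1 : ∀ i, coxeterIsometry n x i ∈ Set.Icc (-1 : ℝ) 1 ↔
          x ((finRotate n).symm i) ∈ Set.Icc (-1 : ℝ) 1 := by
        intro i
        rw [coxeterIsometry_apply]
        split_ifs
        · simp only [Set.mem_Icc]
          constructor <;> rintro ⟨h, h'⟩ <;> constructor <;> linarith
        · rfl
      constructor
      · intro h i
        have := (h1 (finRotate n i)).1 (h _)
        rwa [Equiv.symm_apply_apply] at this
      · intro h i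
        exact (h1 i).2 (h _)
    show coxeterIsometry n '' cube n = cube n
    ext y
    constructor
    · rintro ⟨x, hx, rfl⟩
      exact (key x).2 hx
    · intro hy
      refine ⟨(coxeterIsometry n).symm y, (key _).1 ?_, ?_⟩ <;> simp [hy]⟩

/-- The interval `[I, γ_C]`, that is, `{α ∈ C_n : α ≤ γ_C}`, ordered by `ReflLE`. -/
def Interval (n : ℕ) : Type :=
  {α : hyperoctahedral n // ReflLE α (coxeterElement n)}

instance (n : ℕ) : LE (Interval n) where
  le α β := ReflLE α.1 β.1

/-- The set `{1,…,n,-1,…,-n}`: `Sum.inl i` stands for `i + 1` and `Sum.inr i` for `-(i + 1)`,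
where `i = 0, …, n - 1`. -/
abbrev SignedIndex (n : ℕ) : Type := Fin n ⊕ Fin n

/-- The involution `a ↦ -a` of `{1,…,n,-1,…,-n}`. -/
def SignedIndex.opp {n : ℕ} (a : SignedIndex n) : SignedIndex n := a.swap

/-- The place `0, …, 2n - 1` of an element in the list `1, 2, …, n, -1, -2, …, -n`, which is
also its place in clockwise order around a circle. -/
def SignedIndex.pos {n : ℕ} : SignedIndex n → ℕ
  | Sum.inl i => i
  | Sum.inr i => n + i

/-- The vector `e_a`, where `e_{-i} = -e_i`. -/
def signedVec {n : ℕ} : SignedIndex n → EuclideanSpace ℝ (Fin n)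
  | Sum.inl i => EuclideanSpace.single i 1
  | Sum.inr i => -EuclideanSpace.single i 1

/-- The partition of `{1,…,n,-1,…,-n}` defined by the cycle structure of `α ∈ C_n`: as `α`
permutes the vectors `e_a`, it acts on the indices `a`, and the blocks are the cycles of this
permutation, fixed points included. So `a` and `b` lie in one block iff `α^k e_a = e_b` for some
integer `k`. -/
def cyclePartition {n : ℕ} (α : hyperoctahedral n) : Setoid (SignedIndex n) :=
  (Equiv.Perm.SameCycle.setoid
    (α : EuclideanSpace ℝ (Fin n) ≃ₗᵢ[ℝ] EuclideanSpace ℝ (Fin n)).toEquiv).comap signedVec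

/-- Reiner's noncrossing partitions of type `B_n`: the partitions of `{1,…,n,-1,…,-n}` that are
invariant under `a ↦ -a`, have at most one block `B` with `B = -B`, and are noncrossing for the
circular order `1, 2, …, n, -1, -2, …, -n`. -/
structure IsNoncrossingB {n : ℕ} (π : Setoid (SignedIndex n)) : Prop where
  opp_rel : ∀ a b, π a b → π a.opp b.opp
  zero_block_unique : ∀ a b, π a a.opp → π b b.opp → π a b
  noncrossing : ∀ a b c d : SignedIndex n, a.pos < b.pos → b.pos < c.pos → c.pos < d.pos →
    π a c → π b d → π a b

/-- Reiner's poset of type `B` noncrossing partitions, ordered by refinement: `π ≤ π'` iff every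
block of `π` is contained in a block of `π'`. -/
abbrev NCB (n : ℕ) : Type := {π : Setoid (SignedIndex n) // IsNoncrossingB π}

end CubeGroup

end

/-! The reflection length on `C_n` is linear algebra: `l(α)` is the dimension of the moved space
`range (α - 1)`, the orthogonal complement of the fixed space (`reflectionLength_eq`). So `α ≤ β`
says that the moved spaces of `α` and `α⁻¹β` are complementary in that of `β`. Below a fixed element
the order is then inclusion of moved spaces (`MovedLE.of_moved_le`), and the moved space determines
the element.

The link with the circle is the sum `y` of the `e_a` over an arc from place `p` to just before place
`p + k`. By telescoping, `γ y - y` is the difference of the vectors at places `p + k` and `p`. If `α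
≤ γ` and these places share a cycle of `α`, then `α y = γ y` (`MovedLE.apply_eq`). For `k ≤ n`
nothing in the sum cancels, so `α` shifts the arc as a set by one place; a cycle meeting the
interior and avoiding the endpoints is trapped there, which is noncrossing.

Conversely, given a noncrossing partition, let `α` send each index to the next one of its block
around the circle. Then `α` and `γ` agree on the arc sums between consecutive elements of a block,
so `γ - 1` maps the fixed space of `α⁻¹γ` onto a space containing the moved space of `α`. A
dimension count gives `α ≤ γ` (`movedLE_of_next`).

Refinement gives inclusion of moved spaces at once. The converse pairs them with fixed vectors
supported on blocks and uses uniqueness of the zero block (`rel_of_sub_mem_moved`). The lattice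
property holds because noncrossing partitions are closed under intersection. -/

open Module

namespace CubeGroup

/-! ### Moved spaces, fixed spaces and length-additive factorizations -/

section Isometry

variable {V : Type*} [NormedAddCommGroup V] [InnerProductSpace ℝ V]

theorem isometry_mul_apply (α β : V ≃ₗᵢ[ℝ] V) (x : V) : (α * β) x = α (β x) := rfl

/-- The moved space `range (α - 1)` of an isometry. -/
def moved (α : V ≃ₗᵢ[ℝ] V) : Submodule ℝ V :=
  LinearMap.range (α.toLinearEquiv.toLinearMap - LinearMap.id)

/-- The space `ker (α - 1)` of fixed vectors of an isometry. -/
def fixedSpace (α : V ≃ₗᵢ[ℝ] V) : Submodule ℝ V :=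
  LinearMap.ker (α.toLinearEquiv.toLinearMap - LinearMap.id)

theorem mem_moved {α : V ≃ₗᵢ[ℝ] V} {v : V} : v ∈ moved α ↔ ∃ u, α u - u = v := by
  simp [moved]

theorem mem_fixedSpace {α : V ≃ₗᵢ[ℝ] V} {v : V} : v ∈ fixedSpace α ↔ α v = v := by
  simp [fixedSpace, sub_eq_zero]

theorem sub_mem_moved (α : V ≃ₗᵢ[ℝ] V) (u : V) : α u - u ∈ moved α :=
  mem_moved.2 ⟨u, rfl⟩

theorem fixedSpace_eq_orthogonal (α : V ≃ₗᵢ[ℝ] V) : fixedSpace α = (moved α)ᗮ := by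
  ext x
  rw [mem_fixedSpace, Submodule.mem_orthogonal]
  constructor
  · rintro h _ hv
    obtain ⟨u, rfl⟩ := mem_moved.1 hv
    nth_rewrite 1 [← h]
    rw [inner_sub_left, α.inner_map_map, h, sub_self]
  · intro h
    -- As `α u` runs over the whole space, this forces `α x - x = 0`.
    have h1 : ∀ u, inner ℝ (α u) (α x - x) = 0 := by
      intro u
      have := h _ (sub_mem_moved α u)
      rw [inner_sub_left, sub_eq_zero] at this
      rw [inner_sub_right, α.inner_map_map, this, sub_self]
    have h2 := h1 (α.symm (α x - x))
    rw [α.apply_symm_apply, inner_self_eq_zero, sub_eq_zero] at h2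
    exact h2

theorem fixedSpace_anti {α β : V ≃ₗᵢ[ℝ] V} (h : moved α ≤ moved β) :
    fixedSpace β ≤ fixedSpace α := by
  rw [fixedSpace_eq_orthogonal, fixedSpace_eq_orthogonal]
  exact Submodule.orthogonal_le h

theorem moved_mul_le (α β : V ≃ₗᵢ[ℝ] V) : moved (α * β) ≤ moved α ⊔ moved β := by
  intro v hv
  obtain ⟨u, rfl⟩ := mem_moved.1 hv
  have : (α * β) u - u = (α (β u) - β u) + (β u - u) := by
    rw [isometry_mul_apply]; abel
  rw [this]
  exact Submodule.add_mem_sup (sub_mem_moved _ _) (sub_mem_moved _ _)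

theorem moved_eq_bot_iff {α : V ≃ₗᵢ[ℝ] V} : moved α = ⊥ ↔ α = 1 := by
  constructor
  · intro h
    ext x
    have := sub_mem_moved α x
    rw [h, Submodule.mem_bot, sub_eq_zero] at this
    simpa using this
  · rintro rfl
    rw [eq_bot_iff]
    intro v hv
    obtain ⟨u, rfl⟩ := mem_moved.1 hv
    simp

theorem moved_reflection_le (v : V) : moved (ℝ ∙ v)ᗮ.reflection ≤ ℝ ∙ v := by
  intro x hx
  obtain ⟨u, rfl⟩ := mem_moved.1 hx
  rw [Submodule.reflection_orthogonal_apply, Submodule.reflection_apply]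
  have : -(2 • (ℝ ∙ v).starProjection u - u) - u = -(2 • (ℝ ∙ v).starProjection u) := by abel
  rw [this]
  refine neg_mem (nsmul_mem ?_ 2)
  exact Submodule.starProjection_apply_mem _ _

theorem mem_fixedSpace_inv_mul {α β : V ≃ₗᵢ[ℝ] V} {y : V} :
    y ∈ fixedSpace (α⁻¹ * β) ↔ α y = β y := by
  rw [mem_fixedSpace, isometry_mul_apply]
  constructor
  · intro h
    have := congrArg α h
    rw [← isometry_mul_apply, mul_inv_cancel] at this
    exact this.symm
  · intro h
    rw [← h, ← isometry_mul_apply, inv_mul_cancel]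
    rfl

variable [FiniteDimensional ℝ V]

theorem finrank_moved_add_finrank_fixedSpace (α : V ≃ₗᵢ[ℝ] V) :
    finrank ℝ (moved α) + finrank ℝ (fixedSpace α) = finrank ℝ V :=
  LinearMap.finrank_range_add_finrank_ker _

theorem finrank_moved_mul_le (α β : V ≃ₗᵢ[ℝ] V) :
    finrank ℝ (moved (α * β)) ≤ finrank ℝ (moved α) + finrank ℝ (moved β) :=
  (Submodule.finrank_mono (moved_mul_le α β)).trans (Submodule.finrank_add_le_finrank_add_finrank _ _)

/-- The reflection swaps `α u` and `u`, so the product gains the fixed vector `u`; it keeps those of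
`α`, which are orthogonal to `α u - u`. -/
theorem finrank_moved_reflection_mul {α : V ≃ₗᵢ[ℝ] V} {u : V} (hu : α u - u ≠ 0) :
    finrank ℝ (moved ((ℝ ∙ (α u - u))ᗮ.reflection * α)) + 1 ≤ finrank ℝ (moved α) := by
  have h1 := finrank_moved_add_finrank_fixedSpace α
  have h2 := finrank_moved_add_finrank_fixedSpace ((ℝ ∙ (α u - u))ᗮ.reflection * α)
  have hlt : fixedSpace α < fixedSpace ((ℝ ∙ (α u - u))ᗮ.reflection * α) := by
    rw [SetLike.lt_iff_le_and_exists]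
    refine ⟨?_, u, ?_, ?_⟩
    · intro x hx
      have hx' := mem_fixedSpace.1 hx
      rw [mem_fixedSpace, isometry_mul_apply, hx', Submodule.reflection_eq_self_iff,
        Submodule.mem_orthogonal_singleton_iff_inner_right]
      rw [fixedSpace_eq_orthogonal] at hx
      exact hx _ (sub_mem_moved α u)
    · rw [mem_fixedSpace, isometry_mul_apply]
      exact Submodule.reflection_sub (α.norm_map u)
    · rw [mem_fixedSpace]
      exact fun h => hu (sub_eq_zero.2 h)
  have := Submodule.finrank_lt_finrank_of_lt hlt
  omega

/-- The conditions on `α` and `β` that say that `β = α * (α⁻¹ * β)` is a length-additive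
factorization, the length being the dimension of the moved space. -/
def MovedLE (α β : V ≃ₗᵢ[ℝ] V) : Prop :=
  finrank ℝ (moved β) = finrank ℝ (moved α) + finrank ℝ (moved (α⁻¹ * β))

theorem MovedLE.sup_eq {α β : V ≃ₗᵢ[ℝ] V} (h : MovedLE α β) :
    moved β = moved α ⊔ moved (α⁻¹ * β) := by
  have h1 := moved_mul_le α (α⁻¹ * β)
  rw [mul_inv_cancel_left] at h1
  refine Submodule.eq_of_le_of_finrank_le h1 ?_
  rw [h]
  exact Submodule.finrank_add_le_finrank_add_finrank _ _

theorem MovedLE.moved_le {α β : V ≃ₗᵢ[ℝ] V} (h : MovedLE α β) : moved α ≤ moved β := by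
  rw [h.sup_eq]; exact le_sup_left

theorem MovedLE.disjoint {α β : V ≃ₗᵢ[ℝ] V} (h : MovedLE α β) :
    moved α ⊓ moved (α⁻¹ * β) = ⊥ := by
  have h1 := Submodule.finrank_sup_add_finrank_inf_eq (moved α) (moved (α⁻¹ * β))
  rw [← h.sup_eq, h] at h1
  apply Submodule.finrank_eq_zero.1
  omega

/-- With `z = α⁻¹ β y`, the vector `z - y = (β y - y) - (α z - z)` lies in both of the moved spaces
of `α` and `α⁻¹β`, which meet trivially. -/
theorem MovedLE.apply_eq {α β : V ≃ₗᵢ[ℝ] V} (h : MovedLE α β) {y : V} (hy : β y - y ∈ moved α) :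
    α y = β y := by
  rw [← mem_fixedSpace_inv_mul, mem_fixedSpace]
  have h1 : (α⁻¹ * β) y - y ∈ moved α ⊓ moved (α⁻¹ * β) := by
    refine ⟨?_, sub_mem_moved _ _⟩
    have h2 : α ((α⁻¹ * β) y) = β y := by
      rw [← isometry_mul_apply, mul_inv_cancel_left]
    have h3 := sub_mem hy (sub_mem_moved α ((α⁻¹ * β) y))
    rw [h2] at h3
    rwa [sub_sub_sub_cancel_left] at h3
  rw [h.disjoint, Submodule.mem_bot, sub_eq_zero] at h1
  exact h1

/-- With `δ = α⁻¹β`, the map `α⁻¹α'` fixes `Fix δ + Fix α'`, while `Fix δ ∩ Fix α' ⊆ Fix β`.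
Counting dimensions bounds the moved space of `α⁻¹α'` from above; subadditivity gives the other
inequality. -/
theorem MovedLE.of_moved_le {α α' β : V ≃ₗᵢ[ℝ] V} (h : MovedLE α β) (h' : MovedLE α' β)
    (hle : moved α ≤ moved α') : MovedLE α α' := by
  have hδ : ∀ y ∈ fixedSpace (α⁻¹ * β), α' y = β y := by
    intro y hy
    rw [mem_fixedSpace_inv_mul] at hy
    refine h'.apply_eq (hle ?_)
    rw [← hy]
    exact sub_mem_moved α y
  have h1 : fixedSpace (α⁻¹ * β) ⊔ fixedSpace α' ≤ fixedSpace (α⁻¹ * α') := by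
    refine sup_le ?_ ?_ <;> intro y hy <;> rw [mem_fixedSpace_inv_mul]
    · rw [hδ y hy]
      exact mem_fixedSpace_inv_mul.1 hy
    · rw [mem_fixedSpace.1 hy]
      exact mem_fixedSpace.1 (fixedSpace_anti hle hy)
  have h2 : fixedSpace (α⁻¹ * β) ⊓ fixedSpace α' ≤ fixedSpace β := by
    rintro y ⟨hy, hy'⟩
    rw [mem_fixedSpace, ← hδ y hy]
    exact mem_fixedSpace.1 hy'
  have h3 := Submodule.finrank_mono h1
  have h4 := Submodule.finrank_mono h2
  have h5 := Submodule.finrank_sup_add_finrank_inf_eq (fixedSpace (α⁻¹ * β)) (fixedSpace α')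
  have h6 := finrank_moved_add_finrank_fixedSpace α'
  have h7 := finrank_moved_add_finrank_fixedSpace β
  have h8 := finrank_moved_add_finrank_fixedSpace (α⁻¹ * β)
  have h9 := finrank_moved_add_finrank_fixedSpace (α⁻¹ * α')
  have h10 := finrank_moved_mul_le α (α⁻¹ * α')
  rw [mul_inv_cancel_left] at h10
  unfold MovedLE at *
  omega

theorem MovedLE.eq_of_moved_eq {α β : V ≃ₗᵢ[ℝ] V} (h : MovedLE α β)
    (he : moved α = moved β) : α = β := by
  unfold MovedLE at h
  rw [he] at h
  have : moved (α⁻¹ * β) = ⊥ := Submodule.finrank_eq_zero.1 (by omega)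
  rw [moved_eq_bot_iff] at this
  exact inv_mul_eq_one.1 this

end Isometry

/-! ### The circular order: places modulo `2n`, with opposition as a shift by `n` -/

theorem SignedIndex.opp_opp {n : ℕ} (a : SignedIndex n) : a.opp.opp = a := by
  simp [SignedIndex.opp]

theorem SignedIndex.opp_ne {n : ℕ} (a : SignedIndex n) : a.opp ≠ a := by
  cases a <;> simp [SignedIndex.opp]

theorem SignedIndex.pos_lt {n : ℕ} (a : SignedIndex n) : a.pos < 2 * n := by
  rcases a with ⟨i, hi⟩ | ⟨i, hi⟩ <;> simp [SignedIndex.pos] <;> omega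

theorem SignedIndex.pos_injective {n : ℕ} :
    Function.Injective (SignedIndex.pos : SignedIndex n → ℕ) := by
  rintro (⟨i, hi⟩ | ⟨i, hi⟩) (⟨j, hj⟩ | ⟨j, hj⟩) h <;> simp [SignedIndex.pos] at h ⊢ <;> omega

/-- The element of `{1,…,n,-1,…,-n}` reached from `1` by `k` steps of the circular order
`1, 2, …, n, -1, …, -n`. -/
def atPos (n : ℕ) [NeZero n] (k : ℕ) : SignedIndex n :=
  if k % (2 * n) < n then Sum.inl (Fin.ofNat n k) else Sum.inr (Fin.ofNat n k)

section
variable {n : ℕ} [NeZero n]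

theorem pos_atPos (k : ℕ) : (atPos n k).pos = k % (2 * n) := by
  have h0 : 0 < n := NeZero.pos n
  have h1 : k % (2 * n) % n = k % n := Nat.mod_mod_of_dvd k (Dvd.intro_left 2 rfl)
  have h2 : k % (2 * n) < 2 * n := Nat.mod_lt _ (by omega)
  unfold atPos
  split_ifs with h
  · rw [Nat.mod_eq_of_lt h] at h1
    simp [SignedIndex.pos, h1]
  · rw [Nat.mod_eq_sub_mod (by omega), Nat.mod_eq_of_lt (by omega)] at h1
    simp only [SignedIndex.pos, Fin.ofNat]
    omega

theorem atPos_pos (a : SignedIndex n) : atPos n a.pos = a :=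
  SignedIndex.pos_injective (by rw [pos_atPos, Nat.mod_eq_of_lt a.pos_lt])

theorem atPos_eq_iff {k l : ℕ} : atPos n k = atPos n l ↔ k ≡ l [MOD 2 * n] := by
  rw [← SignedIndex.pos_injective.eq_iff, pos_atPos, pos_atPos]
  rfl

theorem atPos_add_two_mul (k : ℕ) : atPos n (k + 2 * n) = atPos n k := by
  rw [atPos_eq_iff]; simp [Nat.ModEq]

theorem atPos_add_self (k : ℕ) : atPos n (k + n) = (atPos n k).opp := by
  have h0 : 0 < n := NeZero.pos n
  have h2 : k % (2 * n) < 2 * n := Nat.mod_lt _ (by omega)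
  have h3 : (k + n) % (2 * n) < n ↔ ¬ k % (2 * n) < n := by
    rw [Nat.add_mod, Nat.mod_eq_of_lt (show n < 2 * n by omega)]
    by_cases h : k % (2 * n) < n
    · rw [Nat.mod_eq_of_lt (by omega)]; omega
    · rw [Nat.mod_eq_sub_mod (by omega), Nat.mod_eq_of_lt (by omega)]; omega
  have h4 : Fin.ofNat n (k + n) = Fin.ofNat n k := by
    ext; simp [Fin.ofNat]
  unfold atPos
  by_cases h : k % (2 * n) < n
  · rw [if_pos h, if_neg (by tauto), h4]; rfl
  · rw [if_neg h, if_pos (by tauto), h4]; rfl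

theorem atPos_add_inj {p i j : ℕ} (hi : i < 2 * n) (hj : j < 2 * n)
    (h : atPos n (p + i) = atPos n (p + j)) : i = j := by
  rw [atPos_eq_iff] at h
  exact Nat.ModEq.eq_of_lt_of_lt (Nat.ModEq.add_left_cancel' p h) hi hj

theorem exists_atPos_add (p : ℕ) (a : SignedIndex n) : ∃ i < 2 * n, atPos n (p + i) = a := by
  have h0 : 0 < n := NeZero.pos n
  have h2 : p % (2 * n) < 2 * n := Nat.mod_lt _ (by omega)
  refine ⟨(a.pos + (2 * n - p % (2 * n))) % (2 * n), Nat.mod_lt _ (by omega), ?_⟩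
  rw [← atPos_pos a, atPos_eq_iff, atPos_pos]
  have h3 : p + (a.pos + (2 * n - p % (2 * n))) % (2 * n) ≡
      p % (2 * n) + (a.pos + (2 * n - p % (2 * n))) [MOD 2 * n] :=
    Nat.ModEq.add (Nat.mod_modEq _ _).symm (Nat.mod_modEq _ _)
  refine h3.trans ?_
  have : p % (2 * n) + (a.pos + (2 * n - p % (2 * n))) = a.pos + 2 * n := by omega
  rw [this]
  simp [Nat.ModEq]

end

/-! ### The vectors `e_a` and the action of `γ_C` on them -/

theorem signedVec_opp {n : ℕ} (a : SignedIndex n) : signedVec a.opp = -signedVec a := by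
  cases a <;> simp [SignedIndex.opp, signedVec]

theorem inner_signedVec {n : ℕ} (a b : SignedIndex n) :
    inner ℝ (signedVec a) (signedVec b) =
      (if a = b then 1 else 0) - (if a = b.opp then 1 else 0 : ℝ) := by
  rcases a with i | i <;> rcases b with j | j <;>
    simp [SignedIndex.opp, signedVec, EuclideanSpace.inner_single_left]

theorem norm_signedVec {n : ℕ} (a : SignedIndex n) : ‖signedVec a‖ = 1 := by
  cases a <;> simp [signedVec]

theorem signedVec_injective {n : ℕ} :
    Function.Injective (signedVec : SignedIndex n → EuclideanSpace ℝ (Fin n)) := by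
  intro a b h
  have h1 := inner_signedVec a b
  rw [h, inner_signedVec, if_pos rfl, if_neg (SignedIndex.opp_ne b).symm] at h1
  by_contra hab
  rw [if_neg hab] at h1
  split_ifs at h1 <;> norm_num at h1

theorem ext_inner_signedVec {n : ℕ} {x y : EuclideanSpace ℝ (Fin n)}
    (h : ∀ a, inner ℝ (signedVec a) x = inner ℝ (signedVec a) y) : x = y := by
  ext i
  have := h (Sum.inl i)
  simpa [signedVec, EuclideanSpace.inner_single_left] using this

theorem eq_sum_signedVec {n : ℕ} (x : EuclideanSpace ℝ (Fin n)) :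
    x = ∑ i, x i • signedVec (Sum.inl i) := by
  ext j
  simp [signedVec, Finset.sum_apply, Pi.single_apply]

theorem isometry_ext {n : ℕ} {α β : EuclideanSpace ℝ (Fin n) ≃ₗᵢ[ℝ] EuclideanSpace ℝ (Fin n)}
    (h : ∀ a, α (signedVec a) = β (signedVec a)) : α = β := by
  ext1 x
  rw [eq_sum_signedVec x]
  simp only [map_sum, map_smul, h]

theorem mem_cube_iff {n : ℕ} {x : EuclideanSpace ℝ (Fin n)} :
    x ∈ cube n ↔ ∀ a : SignedIndex n, inner ℝ (signedVec a) x ≤ 1 := by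
  simp only [cube, Set.mem_ofPred_eq, Set.mem_Icc, Sum.forall, signedVec, inner_neg_left,
    EuclideanSpace.inner_single_left, map_one, one_mul]
  constructor
  · exact fun h => ⟨fun i => (h i).2, fun i => by linarith [(h i).1]⟩
  · exact fun h i => ⟨by linarith [h.2 i], h.1 i⟩

theorem coxeterIsometry_signedVec {n : ℕ} [NeZero n] (k : ℕ) :
    coxeterIsometry n (signedVec (atPos n k)) = signedVec (atPos n (k + 1)) := by
  obtain ⟨m, rfl⟩ : ∃ m, n = m + 1 := ⟨n - 1, by have := NeZero.pos n; omega⟩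
  have key : ∀ j : Fin (m + 1), coxeterIsometry (m + 1) (signedVec (Sum.inl j)) =
      signedVec (atPos (m + 1) ((j : ℕ) + 1)) := by
    intro j
    have h0 : coxeterIsometry (m + 1) (signedVec (Sum.inl j)) =
        if ((finRotate (m + 1) j : Fin (m + 1)) : ℕ) = 0 then
          -EuclideanSpace.single (finRotate (m + 1) j) 1
        else EuclideanSpace.single (finRotate (m + 1) j) 1 := by
      ext i
      rw [coxeterIsometry_apply]
      generalize finRotate (m + 1) = r
      by_cases hi : i = r j
      · subst hi
        split_ifs <;> simp [signedVec]
      · have : ¬ r.symm i = j := fun h => hi (by rw [← h]; simp)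
        split_ifs <;> simp [signedVec, hi, this]
    rw [h0]
    by_cases hj : j = Fin.last m
    · subst hj
      have : atPos (m + 1) (((Fin.last m : Fin (m + 1)) : ℕ) + 1) = Sum.inr 0 := by
        apply SignedIndex.pos_injective
        rw [pos_atPos, Nat.mod_eq_of_lt] <;> simp [SignedIndex.pos]
      rw [this]
      simp [signedVec]
    · have h1 : ((finRotate (m + 1) j : Fin (m + 1)) : ℕ) = j + 1 := coe_finRotate_of_ne_last hj
      have hlt : (j : ℕ) < m := by
        have := Fin.val_lt_last hj
        simpa using this
      have : atPos (m + 1) ((j : ℕ) + 1) = Sum.inl (finRotate (m + 1) j) := by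
        apply SignedIndex.pos_injective
        rw [pos_atPos, Nat.mod_eq_of_lt (by omega)]
        exact h1.symm
      rw [this, if_neg (by omega)]
      rfl
  obtain ⟨j, hj⟩ | ⟨j, hj⟩ : (∃ j, atPos (m + 1) k = Sum.inl j) ∨
      (∃ j, atPos (m + 1) k = Sum.inr j) := by
    cases atPos (m + 1) k <;> simp
  · rw [hj, key]
    congr 1
    have h1 : k % (2 * (m + 1)) = j := by rw [← pos_atPos, hj]; rfl
    rw [atPos_eq_iff, ← h1]
    exact Nat.ModEq.add_right 1 (Nat.mod_modEq _ _)
  · have h1 : k % (2 * (m + 1)) = (m + 1) + j := by rw [← pos_atPos, hj]; rfl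
    have h2 : (Sum.inr j : SignedIndex (m + 1)) = SignedIndex.opp (Sum.inl j) := rfl
    rw [hj, h2, signedVec_opp, map_neg, key, ← signedVec_opp, ← atPos_add_self]
    congr 1
    rw [atPos_eq_iff]
    have : (j : ℕ) + 1 + (m + 1) = k % (2 * (m + 1)) + 1 := by omega
    rw [this]
    exact Nat.ModEq.add_right 1 (Nat.mod_modEq _ _)

/-! ### Signed permutations and the reflection length of `C_n` -/

section

variable {n : ℕ}

theorem exists_perm_of_forall_exists {α : EuclideanSpace ℝ (Fin n) ≃ₗᵢ[ℝ] EuclideanSpace ℝ (Fin n)}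
    (h : ∀ a, ∃ b, α (signedVec a) = signedVec b) :
    ∃ P : Equiv.Perm (SignedIndex n), ∀ a, α (signedVec a) = signedVec (P a) := by
  choose f hf using h
  have hinj : Function.Injective f := by
    intro a b hab
    apply signedVec_injective
    apply α.injective
    rw [hf, hf, hab]
  exact ⟨Equiv.ofBijective f (Finite.injective_iff_bijective.1 hinj), hf⟩

theorem mem_hyperoctahedral_of_forall_exists
    {α : EuclideanSpace ℝ (Fin n) ≃ₗᵢ[ℝ] EuclideanSpace ℝ (Fin n)}
    (h : ∀ a, ∃ b, α (signedVec a) = signedVec b) : α ∈ hyperoctahedral n := by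
  obtain ⟨P, hP⟩ := exists_perm_of_forall_exists h
  have key : ∀ x, α x ∈ cube n ↔ x ∈ cube n := by
    intro x
    rw [mem_cube_iff, mem_cube_iff]
    constructor
    · intro hx a
      have := hx (P a)
      rwa [← hP, α.inner_map_map] at this
    · intro hx a
      have := hx (P.symm a)
      rwa [← α.inner_map_map, hP, Equiv.apply_symm_apply] at this
  show α '' cube n = cube n
  ext y
  constructor
  · rintro ⟨x, hx, rfl⟩
    exact (key x).2 hx
  · intro hy
    refine ⟨α.symm y, (key _).1 ?_, ?_⟩ <;> simp [hy]

/-- Testing against the sign vector of `y`, a point of the cube, gives `∑ |y i| ≤ 1 = ∑ (y i)²`.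
Hence every `|y i|` is `0` or `1`, and exactly one is `1`. -/
theorem exists_eq_signedVec {y : EuclideanSpace ℝ (Fin n)} (hy : ‖y‖ = 1)
    (h : ∀ x ∈ cube n, inner ℝ x y ≤ 1) : ∃ b, y = signedVec b := by
  have h1 : ∑ i, (y i) ^ 2 = 1 := by
    have := EuclideanSpace.real_norm_sq_eq y
    rw [hy] at this
    linarith
  have hle : ∀ i, |y i| ≤ 1 := by
    intro i
    rw [← sq_le_one_iff_abs_le_one, ← h1]
    exact Finset.single_le_sum (f := fun i => (y i) ^ 2) (fun j _ => sq_nonneg _) (Finset.mem_univ i)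
  have h2 : ∑ i, |y i| ≤ 1 := by
    have h3 := h (WithLp.toLp 2 fun i => (SignType.sign (y i) : ℝ)) (by
      intro i
      show ((SignType.sign (y i) : SignType) : ℝ) ∈ _
      cases SignType.sign (y i) <;> simp)
    refine le_trans (le_of_eq ?_) h3
    rw [PiLp.inner_apply]
    refine Finset.sum_congr rfl fun i _ => ?_
    rw [← sign_mul_self (y i)]
    simp [mul_comm]
  have h4 : ∀ i, |y i| - (y i) ^ 2 = 0 := by
    have hnn : ∀ i ∈ Finset.univ, 0 ≤ |y i| - (y i) ^ 2 := by
      intro i _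
      rw [← sq_abs]
      nlinarith [hle i, abs_nonneg (y i)]
    have h5 : ∑ i, (|y i| - (y i) ^ 2) = 0 := by
      refine le_antisymm ?_ (Finset.sum_nonneg hnn)
      rw [Finset.sum_sub_distrib, h1]
      linarith
    intro i
    exact (Finset.sum_eq_zero_iff_of_nonneg hnn).1 h5 i (Finset.mem_univ i)
  obtain ⟨i, hi⟩ : ∃ i, y i ≠ 0 := by
    by_contra! h0
    simp [h0] at h1
  have hi1 : |y i| = 1 := by
    have h5 := h4 i
    rw [← sq_abs] at h5
    have : |y i| * (1 - |y i|) = 0 := by linarith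
    rcases mul_eq_zero.1 this with h6 | h6
    · exact absurd (abs_eq_zero.1 h6) hi
    · linarith
  have h0 : ∀ j, j ≠ i → y j = 0 := by
    intro j hj
    have h5 := Finset.sum_le_sum_of_subset_of_nonneg (f := fun i => (y i) ^ 2)
      (Finset.subset_univ {i, j}) (fun k _ _ => sq_nonneg _)
    rw [h1, Finset.sum_pair hj.symm, ← sq_abs (y i), hi1] at h5
    nlinarith
  have hsingle : y = EuclideanSpace.single i (y i) := by
    ext j
    by_cases hj : j = i
    · subst hj; simp
    · simp [hj, h0 j hj]
  rcases (abs_eq zero_le_one).1 hi1 with h6 | h6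
  · exact ⟨Sum.inl i, by rw [hsingle, h6]; rfl⟩
  · exact ⟨Sum.inr i, by rw [hsingle, h6]; ext; simp [signedVec, apply_ite]⟩

theorem exists_signedVec_of_mem {α : EuclideanSpace ℝ (Fin n) ≃ₗᵢ[ℝ] EuclideanSpace ℝ (Fin n)}
    (hα : α ∈ hyperoctahedral n) (a : SignedIndex n) : ∃ b, α (signedVec a) = signedVec b := by
  refine exists_eq_signedVec (by rw [α.norm_map, norm_signedVec]) ?_
  intro x hx
  rw [← (show α '' cube n = cube n from hα)] at hx
  obtain ⟨z, hz, rfl⟩ := hx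
  rw [α.inner_map_map, real_inner_comm]
  exact mem_cube_iff.1 hz a

/-- The permutation of `{1,…,n,-1,…,-n}` induced by an element of `C_n`. -/
noncomputable def indexPerm (α : hyperoctahedral n) : Equiv.Perm (SignedIndex n) :=
  (exists_perm_of_forall_exists (exists_signedVec_of_mem α.2)).choose

theorem apply_signedVec (α : hyperoctahedral n) (a : SignedIndex n) :
    α.1 (signedVec a) = signedVec (indexPerm α a) :=
  (exists_perm_of_forall_exists (exists_signedVec_of_mem α.2)).choose_spec a

theorem indexPerm_opp (α : hyperoctahedral n) (a : SignedIndex n) :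
    indexPerm α a.opp = (indexPerm α a).opp := by
  apply signedVec_injective
  rw [signedVec_opp, ← apply_signedVec, ← apply_signedVec, signedVec_opp, map_neg]

theorem pow_apply_signedVec (α : hyperoctahedral n) (k : ℕ) (a : SignedIndex n) :
    (α.1.toEquiv ^ k) (signedVec a) = signedVec ((indexPerm α ^ k) a) := by
  induction k with
  | zero => rfl
  | succ k ih =>
    rw [pow_succ', pow_succ', Equiv.Perm.mul_apply, Equiv.Perm.mul_apply, ih]
    exact apply_signedVec α _

theorem cyclePartition_iff {α : hyperoctahedral n} {a b : SignedIndex n} :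
    cyclePartition α a b ↔ (indexPerm α).SameCycle a b := by
  show Equiv.Perm.SameCycle α.1.toEquiv (signedVec a) (signedVec b) ↔ _
  constructor
  · rintro ⟨k, hk⟩
    refine ⟨k, ?_⟩
    apply signedVec_injective
    obtain ⟨m, rfl | rfl⟩ := k.eq_nat_or_neg
    · rw [← hk, zpow_natCast, zpow_natCast, pow_apply_signedVec]
    · rw [zpow_neg, zpow_natCast, Equiv.Perm.inv_eq_iff_eq] at hk
      have hk' : a = (indexPerm α ^ m) b := by
        apply signedVec_injective
        rw [hk, pow_apply_signedVec]
      rw [zpow_neg, zpow_natCast, hk']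
      exact congrArg signedVec (Equiv.symm_apply_apply _ _)
  · rintro h
    obtain ⟨k, hk⟩ := h.exists_nat_pow_eq
    refine ⟨k, ?_⟩
    rw [zpow_natCast, pow_apply_signedVec, hk]

theorem reflection_mem_hyperoctahedral (a b : SignedIndex n) :
    (ℝ ∙ (signedVec b - signedVec a))ᗮ.reflection ∈ hyperoctahedral n := by
  apply mem_hyperoctahedral_of_forall_exists
  have hb : (ℝ ∙ (signedVec b - signedVec a))ᗮ.reflection (signedVec b) = signedVec a :=
    Submodule.reflection_sub (by rw [norm_signedVec, norm_signedVec])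
  have ha : (ℝ ∙ (signedVec b - signedVec a))ᗮ.reflection (signedVec a) = signedVec b := by
    have h := congrArg (ℝ ∙ (signedVec b - signedVec a))ᗮ.reflection hb
    rw [Submodule.reflection_reflection] at h
    exact h.symm
  intro d
  by_cases h1 : d = a
  · exact ⟨b, by rw [h1, ha]⟩
  by_cases h2 : d = b
  · exact ⟨a, by rw [h2, hb]⟩
  by_cases h3 : d = a.opp
  · exact ⟨b.opp, by rw [h3, signedVec_opp, map_neg, ha, signedVec_opp]⟩
  by_cases h4 : d = b.opp
  · exact ⟨a.opp, by rw [h4, signedVec_opp, map_neg, hb, signedVec_opp]⟩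
  refine ⟨d, ?_⟩
  rw [Submodule.reflection_eq_self_iff, Submodule.mem_orthogonal_singleton_iff_inner_left,
    inner_sub_right, inner_signedVec, inner_signedVec]
  simp [h1, h2, h3, h4]

/-- Some `e_a` is moved, and the reflection in `α e_a - e_a` stays in `C_n` because `α e_a` is again
some `e_b`. Multiplying by it lowers the dimension. -/
theorem exists_reflections (k : ℕ) : ∀ α : hyperoctahedral n, finrank ℝ (moved α.1) ≤ k →
    ∃ L : List (hyperoctahedral n), L.length ≤ finrank ℝ (moved α.1) ∧
      (∀ R ∈ L, IsReflection R) ∧ L.prod = α := by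
  induction k with
  | zero =>
    intro α h
    have := moved_eq_bot_iff.1 (Submodule.finrank_eq_zero.1 (Nat.le_zero.1 h))
    exact ⟨[], by simp, by simp, by rw [List.prod_nil]; exact Subtype.ext this.symm⟩
  | succ k ih =>
    intro α h
    by_cases h1 : α.1 = 1
    · exact ⟨[], by simp, by simp, by rw [List.prod_nil]; exact Subtype.ext h1.symm⟩
    obtain ⟨a, ha⟩ : ∃ a, α.1 (signedVec a) ≠ signedVec a := by
      by_contra! h2
      exact h1 (isometry_ext h2)
    let R : hyperoctahedral n := ⟨_, reflection_mem_hyperoctahedral a (indexPerm α a)⟩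
    have hR : R.1 = (ℝ ∙ (α.1 (signedVec a) - signedVec a))ᗮ.reflection := by
      rw [apply_signedVec]
    have hRR : R * R = 1 := by
      apply Subtype.ext
      show R.1 * R.1 = 1
      rw [hR]
      exact Submodule.reflection_mul_reflection _
    have h3 := finrank_moved_reflection_mul (sub_ne_zero.2 ha)
    rw [← hR] at h3
    have h4 : (R * α).1 = R.1 * α.1 := rfl
    obtain ⟨L, hL1, hL2, hL3⟩ := ih (R * α) (by rw [h4]; omega)
    refine ⟨R :: L, ?_, ?_, ?_⟩
    · rw [h4] at hL1
      rw [List.length_cons]; omega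
    · intro S hS
      rcases List.mem_cons.1 hS with rfl | hS
      · exact ⟨_, sub_ne_zero.2 ha, hR⟩
      · exact hL2 S hS
    · rw [List.prod_cons, hL3, ← mul_assoc, hRR, one_mul]

theorem finrank_moved_prod_le (L : List (hyperoctahedral n)) (h : ∀ R ∈ L, IsReflection R) :
    finrank ℝ (moved L.prod.1) ≤ L.length := by
  induction L with
  | nil =>
    have : moved (([] : List (hyperoctahedral n)).prod).1 = ⊥ := moved_eq_bot_iff.2 rfl
    rw [this]; simp
  | cons R L ih =>
    have h1 := finrank_moved_mul_le R.1 L.prod.1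
    have h2 := ih fun S hS => h S (List.mem_cons_of_mem _ hS)
    have h3 : finrank ℝ (moved R.1) ≤ 1 := by
      obtain ⟨v, -, hv⟩ := h R List.mem_cons_self
      rw [hv]
      refine (Submodule.finrank_mono (moved_reflection_le v)).trans ?_
      exact (finrank_span_le_card ({v} : Set _)).trans (by simp)
    rw [List.prod_cons, List.length_cons]
    show finrank ℝ (moved (R.1 * L.prod.1)) ≤ _
    omega

theorem reflectionLength_eq (α : hyperoctahedral n) :
    reflectionLength α = finrank ℝ (moved α.1) := by
  obtain ⟨L, hL1, hL2, hL3⟩ := exists_reflections _ α le_rfl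
  have hmem : L.length ∈ {k | ∃ L : List (hyperoctahedral n),
      L.length = k ∧ (∀ R ∈ L, IsReflection R) ∧ L.prod = α} :=
    ⟨L, rfl, hL2, hL3⟩
  apply le_antisymm
  · refine le_trans ?_ hL1
    exact Nat.sInf_le hmem
  -- The infimum is attained only because the set is nonempty; `sInf ∅` would be `0`.
  · obtain ⟨L', h1, h2, h3⟩ : ∃ L' : List (hyperoctahedral n), L'.length = reflectionLength α ∧
        (∀ R ∈ L', IsReflection R) ∧ L'.prod = α := Nat.sInf_mem (Set.nonempty_of_mem hmem)
    have := finrank_moved_prod_le L' h2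
    rwa [h3, h1] at this

theorem reflLE_iff {α β : hyperoctahedral n} : ReflLE α β ↔ MovedLE α.1 β.1 := by
  unfold ReflLE MovedLE
  rw [reflectionLength_eq, reflectionLength_eq, reflectionLength_eq]
  rfl

end

/-! ### Elements below `γ_C` have noncrossing cycles -/

section

section
variable {n : ℕ}

theorem sameCycle_opp {α : hyperoctahedral n} {a b : SignedIndex n}
    (h : (indexPerm α).SameCycle a b) : (indexPerm α).SameCycle a.opp b.opp := by
  obtain ⟨k, rfl⟩ := h.exists_nat_pow_eq
  have h1 : ∀ k : ℕ, (indexPerm α ^ k) a.opp = ((indexPerm α ^ k) a).opp := by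
    intro k
    induction k with
    | zero => rfl
    | succ k ih =>
      rw [pow_succ', Equiv.Perm.mul_apply, Equiv.Perm.mul_apply, ih, indexPerm_opp]
  exact ⟨k, by rw [zpow_natCast, h1]⟩

theorem sub_mem_moved_of_sameCycle {α : hyperoctahedral n} {a b : SignedIndex n}
    (h : (indexPerm α).SameCycle a b) : signedVec b - signedVec a ∈ moved α.1 := by
  obtain ⟨k, rfl⟩ := h.exists_nat_pow_eq
  induction k with
  | zero => simp
  | succ k ih =>
    rw [pow_succ', Equiv.Perm.mul_apply, ← apply_signedVec]
    have h1 := add_mem (sub_mem_moved α.1 (signedVec ((indexPerm α ^ k) a))) (ih ⟨k, rfl⟩)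
    rwa [sub_add_sub_cancel] at h1

end

variable {n : ℕ} [NeZero n]

/-- The sum of the vectors `e_a` over `k` consecutive places `a` of the circular order. -/
noncomputable def arcSum (n : ℕ) [NeZero n] (p k : ℕ) : EuclideanSpace ℝ (Fin n) :=
  ∑ i ∈ Finset.range k, signedVec (atPos n (p + i))

theorem coxeterIsometry_arcSum (p k : ℕ) :
    coxeterIsometry n (arcSum n p k) =
      ∑ i ∈ Finset.range k, signedVec (atPos n (p + (i + 1))) := by
  unfold arcSum
  rw [map_sum]
  exact Finset.sum_congr rfl fun i _ => coxeterIsometry_signedVec _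

theorem coxeterIsometry_arcSum_sub (p k : ℕ) :
    coxeterIsometry n (arcSum n p k) - arcSum n p k =
      signedVec (atPos n (p + k)) - signedVec (atPos n p) := by
  rw [coxeterIsometry_arcSum]
  unfold arcSum
  rw [← Finset.sum_sub_distrib,
    Finset.sum_range_sub (fun i => signedVec (atPos n (p + i))), add_zero]

theorem atPos_add_congr {p q : ℕ} (h : atPos n p = atPos n q) (i : ℕ) :
    atPos n (p + i) = atPos n (q + i) := by
  rw [atPos_eq_iff] at h ⊢
  exact h.add_right i

/-- Pair `α y = γ y`, for the arc sum `y`, with the image of one of its vectors. As `k ≤ n`, the arc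
contains no opposite pair, so the left side is at least `1`; if the image lay outside the shifted
arc, the right side would be at most `0`. -/
theorem indexPerm_maps_arc {α : hyperoctahedral n} (h : MovedLE α.1 (coxeterIsometry n))
    {p k i : ℕ} (hk : k ≤ n) (hc : (indexPerm α).SameCycle (atPos n p) (atPos n (p + k)))
    (hi : i < k) : ∃ j < k, indexPerm α (atPos n (p + i)) = atPos n (p + (j + 1)) := by
  by_contra! hcon
  have h0 : 0 < n := NeZero.pos n
  have h1 : α.1 (arcSum n p k) = coxeterIsometry n (arcSum n p k) := by
    apply h.apply_eq
    rw [coxeterIsometry_arcSum_sub]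
    exact sub_mem_moved_of_sameCycle hc
  have h2 := congrArg (inner ℝ (signedVec (indexPerm α (atPos n (p + i))))) h1
  rw [coxeterIsometry_arcSum, inner_sum] at h2
  unfold arcSum at h2
  rw [map_sum, inner_sum] at h2
  have hpos : ∀ j ∈ Finset.range k, (0 : ℝ) ≤ inner ℝ (signedVec (indexPerm α (atPos n (p + i))))
      (α.1 (signedVec (atPos n (p + j)))) := by
    intro j hj
    have hne : indexPerm α (atPos n (p + i)) ≠ (indexPerm α (atPos n (p + j))).opp := by
      intro he
      rw [← indexPerm_opp, (indexPerm α).injective.eq_iff, ← atPos_add_self, add_assoc] at he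
      have hj' := Finset.mem_range.1 hj
      have := atPos_add_inj (by omega) (by omega) he
      omega
    rw [apply_signedVec, inner_signedVec, if_neg hne]
    split_ifs <;> norm_num
  have h3 := Finset.single_le_sum hpos (Finset.mem_range.2 hi)
  rw [h2, apply_signedVec, inner_signedVec, if_pos rfl, if_neg (SignedIndex.opp_ne _).symm] at h3
  have h4 : ∑ j ∈ Finset.range k, inner ℝ (signedVec (indexPerm α (atPos n (p + i))))
      (signedVec (atPos n (p + (j + 1)))) ≤ (0 : ℝ) := by
    refine Finset.sum_nonpos fun j hj => ?_
    rw [inner_signedVec, if_neg (hcon j (Finset.mem_range.1 hj))]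
    split_ifs <;> norm_num
  linarith

/-- An orbit could leave the open arc only through its far end, which belongs to the cycle of `p`.
-/
theorem orbit_mem_arc {α : hyperoctahedral n} (h : MovedLE α.1 (coxeterIsometry n))
    {p k i : ℕ} (hk : k ≤ n) (hc : (indexPerm α).SameCycle (atPos n p) (atPos n (p + k)))
    (hi0 : 0 < i) (hi : i < k) (hn : ¬ (indexPerm α).SameCycle (atPos n p) (atPos n (p + i)))
    {z : SignedIndex n} (hz : (indexPerm α).SameCycle (atPos n (p + i)) z) :
    ∃ j, 0 < j ∧ j < k ∧ z = atPos n (p + j) := by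
  obtain ⟨m, rfl⟩ := hz.exists_nat_pow_eq
  clear hz
  induction m with
  | zero => exact ⟨i, hi0, hi, rfl⟩
  | succ m ih =>
    obtain ⟨j, hj0, hj, hm⟩ := ih
    have hs : (indexPerm α ^ (m + 1)) (atPos n (p + i)) = indexPerm α (atPos n (p + j)) := by
      rw [pow_succ', Equiv.Perm.mul_apply, hm]
    obtain ⟨l, hl, hl'⟩ := indexPerm_maps_arc h hk hc hj
    rw [hs, hl']
    refine ⟨l + 1, by omega, ?_, rfl⟩
    by_contra hlt
    have hlk : l + 1 = k := by omega
    rw [hlk] at hl'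
    rw [hl'] at hs
    apply hn
    refine hc.trans (Equiv.Perm.SameCycle.symm ⟨(m + 1 : ℕ), ?_⟩)
    rw [zpow_natCast, hs]

/-- The noncrossing condition, stated relative to an arbitrary starting place. -/
def CyclicNoncrossing (π : Setoid (SignedIndex n)) : Prop :=
  ∀ p i j m : ℕ, 0 < i → i < j → j < m → m < 2 * n → π (atPos n p) (atPos n (p + j)) →
    π (atPos n (p + i)) (atPos n (p + m)) → π (atPos n p) (atPos n (p + i))

theorem cyclicNoncrossing_cyclePartition {α : hyperoctahedral n}
    (h : MovedLE α.1 (coxeterIsometry n)) : CyclicNoncrossing (cyclePartition α) := by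
  intro p i j m hi hij hjm hm h1 h2
  rw [cyclePartition_iff] at *
  by_contra hn
  -- One of the two arcs cut off by `p` and `p + j` has length at most `n`; if `j > n`, it runs from
  -- `p + j` back to `p`.
  rcases le_or_gt j n with hj | hj
  · obtain ⟨l, -, hl, he⟩ := orbit_mem_arc h hj h1 hi hij hn h2
    have := atPos_add_inj hm (by omega) he
    omega
  · have hp : atPos n (p + j + (2 * n - j)) = atPos n p := by
      rw [← atPos_add_two_mul p]
      congr 1
      omega
    have hq : p + j + (m - j) = p + m := by omega
    have hn' : ¬ (indexPerm α).SameCycle (atPos n (p + j)) (atPos n (p + j + (m - j))) := by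
      rw [hq]
      exact fun h3 => hn ((h1.trans h3).trans h2.symm)
    obtain ⟨l, -, hl, he⟩ := orbit_mem_arc h (k := 2 * n - j) (i := m - j)
      (z := atPos n (p + i)) (by omega) (by rw [hp]; exact h1.symm) (by omega) (by omega) hn' (by rw [hq]; exact h2.symm)
    rw [add_assoc] at he
    have := atPos_add_inj (by omega) (by omega) he
    omega

theorem CyclicNoncrossing.isNoncrossingB {π : Setoid (SignedIndex n)} (h : CyclicNoncrossing π)
    (hopp : ∀ a b, π a b → π a.opp b.opp) : IsNoncrossingB π where
  opp_rel := hopp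
  zero_block_unique := by
    intro a b ha hb
    obtain ⟨i, hi, rfl⟩ := exists_atPos_add a.pos b
    rw [← atPos_add_self, add_assoc] at hb
    generalize hp : a.pos = p at *
    obtain rfl : a = atPos n p := by rw [← hp, atPos_pos]
    have ha' := ha
    rw [← atPos_add_self] at ha'
    rcases Nat.eq_zero_or_pos i with rfl | h0
    · exact π.refl _
    -- Two distinct antipodal pairs cross. For `i > n`, the opposite of `b`, at place `p + (i - n)`,
    -- plays its role.
    rcases lt_trichotomy i n with h1 | rfl | h1
    · exact h p i n (i + n) h0 h1 (by omega) (by omega) ha' hb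
    · exact ha'
    · have he : atPos n (p + (i + n)) = atPos n (p + (i - n)) := by
        rw [← atPos_add_two_mul (p + (i - n))]
        congr 1
        omega
      rw [he] at hb
      have hb' := π.symm hb
      exact π.trans (h p (i - n) n i (by omega) (by omega) h1 hi ha' hb') hb'
  noncrossing := by
    intro a b c d hab hbc hcd hac hbd
    have hd := d.pos_lt
    have e : ∀ x : SignedIndex n, a.pos ≤ x.pos → atPos n (a.pos + (x.pos - a.pos)) = x := by
      intro x hx
      rw [Nat.add_sub_cancel' hx, atPos_pos]
    have h1 := h a.pos (b.pos - a.pos) (c.pos - a.pos) (d.pos - a.pos) (by omega) (by omega)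
      (by omega) (by omega)
    rw [e b (by omega), e c (by omega), e d (by omega), atPos_pos] at h1
    exact h1 hac hbd

theorem IsNoncrossingB.cyclicNoncrossing {π : Setoid (SignedIndex n)} (h : IsNoncrossingB π) :
    CyclicNoncrossing π := by
  intro p i j m hi hij hjm hm hac hbd
  have hp : p % (2 * n) < 2 * n := Nat.mod_lt _ (by omega)
  have e : ∀ i < 2 * n, (atPos n (p + i)).pos = p % (2 * n) + i ∧ p % (2 * n) + i < 2 * n ∨
      (atPos n (p + i)).pos + 2 * n = p % (2 * n) + i := by
    intro i hi
    rw [pos_atPos, Nat.add_mod, Nat.mod_eq_of_lt hi]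
    rcases lt_or_ge (p % (2 * n) + i) (2 * n) with h1 | h1
    · rw [Nat.mod_eq_of_lt h1]; omega
    · rw [Nat.mod_eq_sub_mod h1, Nat.mod_eq_of_lt (by omega)]; omega
  have e0 : (atPos n p).pos = p % (2 * n) := pos_atPos p
  have h1 := e i (by omega)
  have h2 := e j (by omega)
  have h3 := e m (by omega)
  generalize atPos n p = a at *
  generalize atPos n (p + i) = b at *
  generalize atPos n (p + j) = c at *
  generalize atPos n (p + m) = d at *
  clear e
  -- The cases record how many of the four places pass the end of the list; each is a rotation of
  -- the linear condition.
  rcases h3 with h3 | h3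
  · exact h.noncrossing a b c d (by omega) (by omega) (by omega) hac hbd
  rcases h2 with h2 | h2
  · exact π.trans (π.symm (h.noncrossing d a b c (by omega) (by omega) (by omega)
      (π.symm hbd) hac)) (π.symm hbd)
  rcases h1 with h1 | h1
  · exact π.trans hac (π.trans (h.noncrossing c d a b (by omega) (by omega) (by omega)
      (π.symm hac) (π.symm hbd)) (π.symm hbd))
  · exact π.trans hac (π.symm (h.noncrossing b c d a (by omega) (by omega) (by omega)
      hbd (π.symm hac)))

end

/-! ### From noncrossing partitions back to elements below `γ_C` -/

section
variable {n : ℕ}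

theorem exists_hyperoctahedral_of_comm (f : SignedIndex n → SignedIndex n)
    (hf : Function.Injective f) (hopp : ∀ a, f a.opp = (f a).opp) :
    ∃ α : hyperoctahedral n, ∀ a, indexPerm α a = f a := by
  have hon : Orthonormal ℝ fun i : Fin n => signedVec (f (Sum.inl i)) := by
    rw [orthonormal_iff_ite]
    intro i j
    rw [inner_signedVec, ← hopp]
    simp [hf.eq_iff, SignedIndex.opp]
  have hspan : ⊤ ≤ Submodule.span ℝ (Set.range fun i : Fin n => signedVec (f (Sum.inl i))) := by
    rw [hon.linearIndependent.span_eq_top_of_card_eq_finrank' (by simp)]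
  let B := OrthonormalBasis.mk hon hspan
  let α := (EuclideanSpace.basisFun (Fin n) ℝ).equiv B (Equiv.refl _)
  have h1 : ∀ i, α (signedVec (Sum.inl i)) = signedVec (f (Sum.inl i)) := by
    intro i
    have h2 := OrthonormalBasis.equiv_apply_basis (EuclideanSpace.basisFun (Fin n) ℝ) B
      (Equiv.refl _) i
    rw [EuclideanSpace.basisFun_apply, Equiv.refl_apply, OrthonormalBasis.coe_mk] at h2
    exact h2
  have h3 : ∀ a, α (signedVec a) = signedVec (f a) := by
    rintro (i | i)
    · exact h1 i
    · have : (Sum.inr i : SignedIndex n) = SignedIndex.opp (Sum.inl i) := rfl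
      rw [this, signedVec_opp, map_neg, h1, hopp, signedVec_opp]
  refine ⟨⟨α, mem_hyperoctahedral_of_forall_exists fun a => ⟨_, h3 a⟩⟩, fun a => ?_⟩
  apply signedVec_injective
  rw [← apply_signedVec]
  exact h3 a

end

section
variable {n : ℕ} [NeZero n]

/-- `k` is the number of steps from the place `p` to the next place of the same block. -/
structure IsStep (π : Setoid (SignedIndex n)) (p k : ℕ) : Prop where
  pos : 0 < k
  le : k ≤ 2 * n
  rel : π (atPos n p) (atPos n (p + k))
  not_rel : ∀ i, 0 < i → i < k → ¬ π (atPos n p) (atPos n (p + i))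

theorem IsStep.unique {π : Setoid (SignedIndex n)} {p k l : ℕ} (hk : IsStep π p k)
    (hl : IsStep π p l) : k = l := by
  rcases lt_trichotomy k l with h | h | h
  · exact absurd hk.rel (hl.not_rel k hk.pos h)
  · exact h
  · exact absurd hl.rel (hk.not_rel l hl.pos h)

theorem exists_next (π : Setoid (SignedIndex n)) : ∃ f : SignedIndex n → SignedIndex n,
    ∀ p, ∃ k, IsStep π p k ∧ f (atPos n p) = atPos n (p + k) := by
  classical
  have h0 : 0 < n := NeZero.pos n
  have h : ∀ a : SignedIndex n, ∃ k, IsStep π a.pos k := by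
    intro a
    have hex : ∃ k, 0 < k ∧ π (atPos n a.pos) (atPos n (a.pos + k)) :=
      ⟨2 * n, by omega, by rw [atPos_add_two_mul]⟩
    refine ⟨Nat.find hex, (Nat.find_spec hex).1, ?_, (Nat.find_spec hex).2, ?_⟩
    · exact Nat.find_min' hex ⟨by omega, by rw [atPos_add_two_mul]⟩
    · exact fun i hi hlt hr => Nat.find_min hex hlt ⟨hi, hr⟩
  choose s hs using h
  refine ⟨fun a => atPos n (a.pos + s a), fun p => ⟨s (atPos n p), ?_, ?_⟩⟩
  · have hp := atPos_pos (atPos n p)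
    have h2 := hs (atPos n p)
    refine ⟨h2.pos, h2.le, ?_, fun i hi hlt => ?_⟩
    · have := h2.rel
      rwa [atPos_add_congr hp, hp] at this
    · have := h2.not_rel i hi hlt
      rwa [atPos_add_congr hp, hp] at this
  · exact atPos_add_congr (atPos_pos _) _

theorem next_injective {π : Setoid (SignedIndex n)} {f : SignedIndex n → SignedIndex n}
    (hf : ∀ p, ∃ k, IsStep π p k ∧ f (atPos n p) = atPos n (p + k)) : Function.Injective f := by
  intro a b hab
  obtain ⟨k, hk, hka⟩ := hf a.pos
  obtain ⟨l, hl, hlb⟩ := hf b.pos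
  have ha := atPos_pos a
  have hb := atPos_pos b
  generalize a.pos = p at *
  generalize b.pos = q at *
  subst ha hb
  clear hf
  wlog hkl : k ≤ l generalizing p q k l
  · exact (this l k q hl hlb p hk hka hab.symm (by omega)).symm
  have h1 : atPos n (p + k) = atPos n (q + l) := by rw [← hka, ← hlb, hab]
  -- Going `2n - k` steps forward amounts to going `k` steps back: `a` is `l - k` steps after `b`,
  -- within one block, against the minimality of `l`.
  have h2 := atPos_add_congr h1 (2 * n - k)
  have hk1 := hk.le
  have e1 : p + k + (2 * n - k) = p + 2 * n := by omega
  have e2 : q + l + (2 * n - k) = q + (l - k) + 2 * n := by omega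
  rw [e1, e2, atPos_add_two_mul, atPos_add_two_mul] at h2
  rcases hkl.eq_or_lt with rfl | hlt
  · rw [h2, Nat.sub_self, Nat.add_zero]
  · have hk0 := hk.pos
    refine absurd ?_ (hl.not_rel (l - k) (by omega) (by omega))
    rw [← h2]
    refine π.trans hl.rel ?_
    rw [← h1]
    exact π.symm hk.rel

theorem next_opp {π : Setoid (SignedIndex n)} {f : SignedIndex n → SignedIndex n}
    (hf : ∀ p, ∃ k, IsStep π p k ∧ f (atPos n p) = atPos n (p + k))
    (hopp : ∀ a b, π a b → π a.opp b.opp) (a : SignedIndex n) : f a.opp = (f a).opp := by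
  obtain ⟨k, hk, hka⟩ := hf a.pos
  obtain ⟨l, hl, hlb⟩ := hf (a.pos + n)
  have e : ∀ i, atPos n (a.pos + n + i) = (atPos n (a.pos + i)).opp := by
    intro i
    rw [← atPos_add_self]
    congr 1
    omega
  have hopp' : ∀ a b : SignedIndex n, π a.opp b.opp → π a b := by
    intro a b h
    have := hopp _ _ h
    rwa [SignedIndex.opp_opp, SignedIndex.opp_opp] at this
  have h1 : IsStep π a.pos l := by
    refine ⟨hl.pos, hl.le, ?_, fun i hi hlt hr => ?_⟩
    · apply hopp'
      rw [← e, ← atPos_add_self]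
      exact hl.rel
    · apply hl.not_rel i hi hlt
      rw [e, atPos_add_self]
      exact hopp _ _ hr
  obtain rfl := hk.unique h1
  rw [e, atPos_add_self] at hlb
  rw [atPos_pos] at hka hlb
  rw [hlb, hka]

theorem cyclePartition_eq_of_next {π : Setoid (SignedIndex n)} {α : hyperoctahedral n}
    (hα : ∀ p, ∃ k, IsStep π p k ∧ indexPerm α (atPos n p) = atPos n (p + k)) :
    cyclePartition α = π := by
  ext a b
  rw [cyclePartition_iff]
  constructor
  · intro h
    obtain ⟨m, rfl⟩ := h.exists_nat_pow_eq
    clear h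
    induction m with
    | zero => exact π.refl _
    | succ m ih =>
      refine π.trans ih ?_
      rw [pow_succ', Equiv.Perm.mul_apply]
      generalize (indexPerm α ^ m) a = c
      obtain ⟨k, hk, hkc⟩ := hα c.pos
      have := hk.rel
      rwa [← hkc, atPos_pos] at this
  -- Induction on the distance: the next element of the block never overshoots the target.
  · have key : ∀ m p, π (atPos n p) (atPos n (p + m)) →
        (indexPerm α).SameCycle (atPos n p) (atPos n (p + m)) := by
      intro m
      induction m using Nat.strong_induction_on with
      | _ m ih =>
        intro p hp
        rcases Nat.eq_zero_or_pos m with rfl | h0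
        · exact Equiv.Perm.SameCycle.refl _ _
        obtain ⟨k, hk, hkp⟩ := hα p
        have hkm : k ≤ m := by
          by_contra hlt
          exact hk.not_rel m h0 (by omega) hp
        have hk0 := hk.pos
        have e : p + m = p + k + (m - k) := by omega
        have h1 := ih (m - k) (by omega) (p + k)
        rw [← e] at h1
        have h2 := h1 (π.trans (π.symm hk.rel) hp)
        rw [← hkp] at h2
        exact Equiv.Perm.sameCycle_apply_left.1 h2
    intro h
    obtain ⟨i, -, rfl⟩ := exists_atPos_add a.pos b
    have := key i a.pos
    rw [atPos_pos] at this
    exact this h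

/-- A step from inside the gap to a place beyond it would cross the pair `p`, `p + k`. If the step
passes `p` again, it ends inside the gap because `l ≤ 2n`. -/
theorem next_mem_arc {π : Setoid (SignedIndex n)} (hπ : CyclicNoncrossing π) {p k i l : ℕ}
    (hk : IsStep π p k) (hi0 : 0 < i) (hi : i < k) (hl : IsStep π (p + i) l) :
    ∃ j, 0 < j ∧ j < k ∧ atPos n (p + i + l) = atPos n (p + j) := by
  have hl0 := hl.pos
  have hl1 := hl.le
  have hk1 := hk.le
  have hr := hl.rel
  have hnr := hk.not_rel i hi0 hi
  rw [add_assoc] at hr ⊢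
  rcases lt_trichotomy (i + l) k with h | h | h
  · exact ⟨i + l, by omega, h, rfl⟩
  · rw [h] at hr
    exact absurd (π.trans hk.rel (π.symm hr)) hnr
  rcases lt_trichotomy (i + l) (2 * n) with h1 | h1 | h1
  · exact absurd (hπ p i k (i + l) hi0 hi h h1 hk.rel hr) hnr
  · rw [h1, atPos_add_two_mul] at hr
    exact absurd (π.symm hr) hnr
  · refine ⟨i + l - 2 * n, by omega, by omega, ?_⟩
    rw [← atPos_add_two_mul (p + (i + l - 2 * n))]
    congr 1
    omega

/-- `α` permutes the interior of the gap and sends `p` to `p + k`, so on the whole arc it has the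
same image set as `γ_C`. -/
theorem apply_arcSum_of_next {π : Setoid (SignedIndex n)} (hπ : CyclicNoncrossing π)
    {α : hyperoctahedral n}
    (hα : ∀ p, ∃ k, IsStep π p k ∧ indexPerm α (atPos n p) = atPos n (p + k)) {p k : ℕ}
    (hk : IsStep π p k) : α.1 (arcSum n p k) = coxeterIsometry n (arcSum n p k) := by
  have hk1 := hk.le
  obtain ⟨m, rfl⟩ : ∃ m, k = m + 1 := ⟨k - 1, by have := hk.pos; omega⟩
  let T := (Finset.range m).image fun i => atPos n (p + (i + 1))
  have hT : ∀ g : SignedIndex n → EuclideanSpace ℝ (Fin n),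
      ∑ t ∈ T, g t = ∑ i ∈ Finset.range m, g (atPos n (p + (i + 1))) := by
    intro g
    refine Finset.sum_image fun i hi j hj h => ?_
    have hi' := Finset.mem_range.1 hi
    have hj' := Finset.mem_range.1 hj
    have := atPos_add_inj (by omega) (by omega) h
    omega
  have hmaps : T.image (indexPerm α) = T := by
    refine Finset.eq_of_subset_of_card_le ?_
      (Finset.card_image_of_injective _ (indexPerm α).injective).ge
    intro b hb
    obtain ⟨a, ha, rfl⟩ := Finset.mem_image.1 hb
    obtain ⟨i, hi, rfl⟩ := Finset.mem_image.1 ha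
    have hi' := Finset.mem_range.1 hi
    obtain ⟨l, hl, hla⟩ := hα (p + (i + 1))
    obtain ⟨j, hj0, hj, hj'⟩ := next_mem_arc hπ hk (by omega) (by omega) hl
    refine Finset.mem_image.2 ⟨j - 1, Finset.mem_range.2 (by omega), ?_⟩
    rw [hla, hj', Nat.sub_add_cancel hj0]
  have hsum : ∑ i ∈ Finset.range m, α.1 (signedVec (atPos n (p + (i + 1)))) =
      ∑ i ∈ Finset.range m, signedVec (atPos n (p + (i + 1))) := by
    rw [← hT fun t => α.1 (signedVec t), ← hT fun t => signedVec t]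
    nth_rewrite 2 [← hmaps]
    rw [Finset.sum_image fun a _ b _ h => (indexPerm α).injective h]
    exact Finset.sum_congr rfl fun a _ => apply_signedVec α a
  obtain ⟨l, hl, hla⟩ := hα p
  obtain rfl := hk.unique hl
  rw [coxeterIsometry_arcSum]
  unfold arcSum
  rw [map_sum, Finset.sum_range_succ', hsum, Finset.sum_range_succ, add_zero, apply_signedVec, hla]

/-- A fixed vector has the same inner product with every `e_a`, in particular with `e_a` and `-e_a`.
-/
theorem fixedSpace_coxeterIsometry : fixedSpace (coxeterIsometry n) = ⊥ := by
  rw [eq_bot_iff]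
  intro x hx
  rw [mem_fixedSpace] at hx
  have h1 : ∀ p m, (inner ℝ (signedVec (atPos n (p + m))) x : ℝ) =
      inner ℝ (signedVec (atPos n p)) x := by
    intro p m
    induction m with
    | zero => rfl
    | succ m ih =>
      rw [← ih, ← (coxeterIsometry n).inner_map_map (signedVec (atPos n (p + m))), hx,
        coxeterIsometry_signedVec]
      rfl
  rw [Submodule.mem_bot]
  apply ext_inner_signedVec
  intro a
  have := h1 a.pos n
  rw [atPos_add_self, atPos_pos, signedVec_opp, inner_neg_left] at this
  rw [inner_zero_right]
  linarith

theorem movedLE_of_next {π : Setoid (SignedIndex n)} (hπ : CyclicNoncrossing π)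
    {α : hyperoctahedral n}
    (hα : ∀ p, ∃ k, IsStep π p k ∧ indexPerm α (atPos n p) = atPos n (p + k)) :
    MovedLE α.1 (coxeterIsometry n) := by
  have h1 : moved α.1 ≤ (fixedSpace (α.1⁻¹ * coxeterIsometry n)).map
      ((coxeterIsometry n).toLinearEquiv.toLinearMap - LinearMap.id) := by
    have key : ∀ a, α.1 (signedVec a) - signedVec a ∈
        (fixedSpace (α.1⁻¹ * coxeterIsometry n)).map
          ((coxeterIsometry n).toLinearEquiv.toLinearMap - LinearMap.id) := by
      intro a
      obtain ⟨k, hk, hka⟩ := hα a.pos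
      refine ⟨arcSum n a.pos k, mem_fixedSpace_inv_mul.2 (apply_arcSum_of_next hπ hα hk), ?_⟩
      have := coxeterIsometry_arcSum_sub (n := n) a.pos k
      rw [← hka, atPos_pos, ← apply_signedVec] at this
      exact this
    intro v hv
    obtain ⟨u, rfl⟩ := mem_moved.1 hv
    rw [eq_sum_signedVec u, map_sum, ← Finset.sum_sub_distrib]
    refine Submodule.sum_mem _ fun i _ => ?_
    rw [map_smul, ← smul_sub]
    exact Submodule.smul_mem _ _ (key _)
  -- This gives `dim moved α ≤ n - dim moved (α⁻¹γ)`. Since `γ` moves all `n` dimensions,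
  -- subadditivity yields equality.
  have h2 := (Submodule.finrank_mono h1).trans (Submodule.finrank_map_le _ _)
  have h3 := finrank_moved_add_finrank_fixedSpace (α.1⁻¹ * coxeterIsometry n)
  have h4 := finrank_moved_add_finrank_fixedSpace (coxeterIsometry n)
  rw [fixedSpace_coxeterIsometry, finrank_bot] at h4
  have h5 := finrank_moved_mul_le α.1 (α.1⁻¹ * coxeterIsometry n)
  rw [mul_inv_cancel_left] at h5
  unfold MovedLE
  omega

end

/-! ### The order isomorphism and the lattice property -/

section

variable {n : ℕ}

theorem reflLE_coxeterElement_iff {α : hyperoctahedral n} :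
    ReflLE α (coxeterElement n) ↔ MovedLE α.1 (coxeterIsometry n) := reflLE_iff

theorem isNoncrossingB_cyclePartition {α : hyperoctahedral n} (h : ReflLE α (coxeterElement n)) :
    IsNoncrossingB (cyclePartition α) := by
  rcases Nat.eq_zero_or_pos n with rfl | hn
  · exact ⟨fun a => isEmptyElim a, fun a => isEmptyElim a, fun a => isEmptyElim a⟩
  · have : NeZero n := ⟨hn.ne'⟩
    have h' := cyclicNoncrossing_cyclePartition (reflLE_coxeterElement_iff.1 h)
    refine h'.isNoncrossingB fun a b hab => ?_
    rw [cyclePartition_iff] at *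
    exact sameCycle_opp hab

theorem exists_cyclePartition_eq {π : Setoid (SignedIndex n)} (hπ : IsNoncrossingB π) :
    ∃ α : hyperoctahedral n, ReflLE α (coxeterElement n) ∧ cyclePartition α = π := by
  rcases Nat.eq_zero_or_pos n with rfl | hn
  · refine ⟨coxeterElement 0, ?_, Setoid.ext fun a => isEmptyElim a⟩
    rw [reflLE_iff]
    unfold MovedLE
    rw [inv_mul_cancel, moved_eq_bot_iff.2 rfl, finrank_bot, add_zero]
  · have : NeZero n := ⟨hn.ne'⟩
    obtain ⟨f, hf⟩ := exists_next π
    obtain ⟨α, hα⟩ := exists_hyperoctahedral_of_comm f (next_injective hf)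
      (next_opp hf hπ.opp_rel)
    have hα' : ∀ p, ∃ k, IsStep π p k ∧ indexPerm α (atPos n p) = atPos n (p + k) := by
      intro p
      rw [hα]
      exact hf p
    exact ⟨α, reflLE_coxeterElement_iff.2 (movedLE_of_next hπ.cyclicNoncrossing hα'),
      cyclePartition_eq_of_next hα'⟩

theorem moved_le_of_cyclePartition_le {α β : hyperoctahedral n}
    (h : cyclePartition α ≤ cyclePartition β) : moved α.1 ≤ moved β.1 := by
  intro v hv
  obtain ⟨u, rfl⟩ := mem_moved.1 hv
  rw [eq_sum_signedVec u, map_sum, ← Finset.sum_sub_distrib]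
  refine Submodule.sum_mem _ fun i _ => ?_
  rw [map_smul, ← smul_sub, apply_signedVec]
  refine Submodule.smul_mem _ _ (sub_mem_moved_of_sameCycle ?_)
  rw [← cyclePartition_iff]
  refine h ?_
  show cyclePartition α _ _
  rw [cyclePartition_iff, Equiv.Perm.sameCycle_apply_right]

/-- The difference of the indicator functions of the block of `a` and of its opposite, as a
vector. -/
noncomputable def blockVec (π : Setoid (SignedIndex n)) (a : SignedIndex n) :
    EuclideanSpace ℝ (Fin n) :=
  open Classical in
  WithLp.toLp 2 fun i => (if π a (Sum.inl i) then 1 else 0) - (if π a (Sum.inr i) then 1 else 0)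

open Classical in
theorem inner_signedVec_blockVec (π : Setoid (SignedIndex n)) (a b : SignedIndex n) :
    inner ℝ (signedVec b) (blockVec π a) =
      (if π a b then 1 else 0) - (if π a b.opp then 1 else 0 : ℝ) := by
  rcases b with i | i
  · have h : SignedIndex.opp (Sum.inl i : SignedIndex n) = Sum.inr i := rfl
    simp [h, blockVec, signedVec, EuclideanSpace.inner_single_left]
  · have h : SignedIndex.opp (Sum.inr i : SignedIndex n) = Sum.inl i := rfl
    simp [h, blockVec, signedVec, EuclideanSpace.inner_single_left]

/-- The block vectors are fixed by `α`, hence orthogonal to `e_b - e_a`. If `a` and `b` lay in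
different blocks, pairing with their block vectors would force both blocks to be zero blocks, hence
equal. -/
theorem rel_of_sub_mem_moved {α : hyperoctahedral n} (hα : IsNoncrossingB (cyclePartition α))
    {a b : SignedIndex n} (h : signedVec b - signedVec a ∈ moved α.1) : cyclePartition α a b := by
  have hfix : ∀ c, blockVec (cyclePartition α) c ∈ fixedSpace α.1 := by
    intro c
    rw [mem_fixedSpace]
    apply ext_inner_signedVec
    intro d
    obtain ⟨e, rfl⟩ := (indexPerm α).surjective d
    rw [← apply_signedVec, α.1.inner_map_map, apply_signedVec, inner_signedVec_blockVec,
      inner_signedVec_blockVec, ← indexPerm_opp]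
    simp only [cyclePartition_iff, Equiv.Perm.sameCycle_apply_right]
  have hinner : ∀ c, (inner ℝ (signedVec b) (blockVec (cyclePartition α) c) : ℝ) =
      inner ℝ (signedVec a) (blockVec (cyclePartition α) c) := by
    intro c
    have h1 := hfix c
    rw [fixedSpace_eq_orthogonal, Submodule.mem_orthogonal] at h1
    rw [← sub_eq_zero, ← inner_sub_left]
    exact h1 _ h
  generalize cyclePartition α = π at *
  by_contra hab
  have hba : ¬ π b a := fun h => hab (π.symm h)
  have h1 := hinner a
  have h2 := hinner b
  rw [inner_signedVec_blockVec, inner_signedVec_blockVec, if_neg hab, if_pos (π.refl a)] at h1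
  rw [inner_signedVec_blockVec, inner_signedVec_blockVec, if_neg hba, if_pos (π.refl b)] at h2
  have ha : π a a.opp := by
    by_contra ha
    rw [if_neg ha] at h1
    split_ifs at h1 <;> norm_num at h1
  have hb : π b b.opp := by
    by_contra hb
    rw [if_neg hb] at h2
    split_ifs at h2 <;> norm_num at h2
  exact hab (hα.zero_block_unique a b ha hb)

theorem reflLE_iff_cyclePartition_le {α β : hyperoctahedral n}
    (hα : ReflLE α (coxeterElement n)) (hβ : ReflLE β (coxeterElement n)) :
    ReflLE α β ↔ cyclePartition α ≤ cyclePartition β := by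
  constructor
  · intro h a b hab
    refine rel_of_sub_mem_moved (isNoncrossingB_cyclePartition hβ) ?_
    exact (reflLE_iff.1 h).moved_le (sub_mem_moved_of_sameCycle (cyclePartition_iff.1 hab))
  · intro h
    exact reflLE_iff.2 ((reflLE_iff.1 hα).of_moved_le (reflLE_iff.1 hβ)
      (moved_le_of_cyclePartition_le h))

theorem cyclePartition_injOn {α β : hyperoctahedral n}
    (hα : ReflLE α (coxeterElement n)) (hβ : ReflLE β (coxeterElement n))
    (h : cyclePartition α = cyclePartition β) : α = β := by
  apply Subtype.ext
  exact (reflLE_iff.1 ((reflLE_iff_cyclePartition_le hα hβ).2 h.le)).eq_of_moved_eq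
    (le_antisymm (moved_le_of_cyclePartition_le h.le) (moved_le_of_cyclePartition_le h.ge))

/-- The isomorphism from `[I, γ_C]` to the noncrossing partitions of type `B`. -/
noncomputable def cyclePartitionIso (n : ℕ) : Interval n ≃o NCB n where
  toEquiv := Equiv.ofBijective
    (fun α => ⟨cyclePartition α.1, isNoncrossingB_cyclePartition α.2⟩)
    ⟨fun α β h => Subtype.ext (cyclePartition_injOn α.2 β.2 (congrArg Subtype.val h)),
      fun π => by
        obtain ⟨α, hα, h⟩ := exists_cyclePartition_eq π.2
        exact ⟨⟨α, hα⟩, Subtype.ext h⟩⟩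
  map_rel_iff' {α β} := (reflLE_iff_cyclePartition_le α.2 β.2).symm

theorem isNoncrossingB_sInf (S : Set (Setoid (SignedIndex n)))
    (h : ∀ π ∈ S, IsNoncrossingB π) : IsNoncrossingB (sInf S) where
  opp_rel a b hab π hπ := (h π hπ).opp_rel a b (hab π hπ)
  zero_block_unique a b ha hb π hπ := (h π hπ).zero_block_unique a b (ha π hπ) (hb π hπ)
  noncrossing a b c d h1 h2 h3 hac hbd π hπ :=
    (h π hπ).noncrossing a b c d h1 h2 h3 (hac π hπ) (hbd π hπ)

instance : InfSet (NCB n) where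
  sInf S := ⟨sInf (Subtype.val '' S), isNoncrossingB_sInf _ (by
    rintro _ ⟨π, -, rfl⟩
    exact π.2)⟩

/-- The noncrossing partitions of type `B` form a complete lattice, being closed under
intersection. -/
@[reducible] noncomputable def completeLatticeNCB (n : ℕ) : CompleteLattice (NCB n) :=
  completeLatticeOfInf (NCB n) fun S => by
    constructor
    · intro π hπ
      exact sInf_le (a := π.1) (Set.mem_image_of_mem _ hπ)
    · intro π hπ
      refine le_sInf (a := π.1) ?_
      rintro _ ⟨ρ, hρ, rfl⟩
      exact hπ hρ

theorem exists_lattice_interval (n : ℕ) : ∃ L : Lattice (Interval n),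
    ∀ α β : Interval n, L.le α β ↔ ReflLE α.1 β.1 := by
  let _ := completeLatticeNCB n
  let f := cyclePartitionIso n
  have hf : ∀ α β : Interval n, ReflLE α.1 β.1 ↔ f α ≤ f β := fun α β => f.le_iff_le.symm
  refine ⟨{ le := fun α β => ReflLE α.1 β.1
            le_refl := fun α => (hf _ _).2 le_rfl
            le_trans := fun α β γ h h' => (hf _ _).2 (((hf _ _).1 h).trans ((hf _ _).1 h'))
            le_antisymm := fun α β h h' =>
              f.injective (le_antisymm ((hf _ _).1 h) ((hf _ _).1 h'))
            sup := fun α β => f.symm (f α ⊔ f β)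
            inf := fun α β => f.symm (f α ⊓ f β)
            le_sup_left := fun α β => ?_
            le_sup_right := fun α β => ?_
            sup_le := fun α β γ h h' => ?_
            inf_le_left := fun α β => ?_
            inf_le_right := fun α β => ?_
            le_inf := fun α β γ h h' => ?_ }, fun α β => Iff.rfl⟩
  all_goals
    refine (hf _ _).2 ?_
    rw [OrderIso.apply_symm_apply]
  · exact le_sup_left
  · exact le_sup_right
  · exact sup_le ((hf _ _).1 h) ((hf _ _).1 h')
  · exact inf_le_left
  · exact inf_le_right
  · exact le_inf ((hf _ _).1 h) ((hf _ _).1 h')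

end

end CubeGroup

theorem mainTheorem1 (n : ℕ) :
    (∃ f : CubeGroup.Interval n ≃o CubeGroup.NCB n,
      ∀ α : CubeGroup.Interval n, (f α).1 = CubeGroup.cyclePartition α.1) ∧
    (∃ L : Lattice (CubeGroup.Interval n),
      ∀ α β : CubeGroup.Interval n, L.le α β ↔ CubeGroup.ReflLE α.1 β.1) :=
  ⟨⟨CubeGroup.cyclePartitionIso n, fun _ => rfl⟩, CubeGroup.exists_lattice_interval n⟩
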